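/- Let $n \ge 2$, let $\Delta^{(n)} = \{p \in \mathbb{R}^n : p_i > 0 \text{ for all } i,\ \sum_i p_i = 1\}$ be the open unit simplex, $\overline{\Delta^{(n)}}$ its closure, $e(1) = (1, 0, \dots, 0)$ and $\overline{e} = (1/n, \dots, 1/n)$. A portfolio is a Borel measurable map $\pi : \Delta^{(n)} \to \overline{\Delta^{(n)}}$. For a sequence $\mu = (\mu(t))_{t = 0, 1, 2, \dots}$ in $\Delta^{(n)}$, its relative value process is given by $V_\pi(0) = 1$ and $$V_\pi(t+1) = V_\pi(t)\left(1 + \sum_{i=1}^n \frac{\pi_i(\mu(t))}{\mu_i(t)}\,\bigl(\mu_i(t+1) - \mu_i(t)\bigr)\right).$$ A portfolio $\tau$ dominates $\pi$ on compacts if for every compact $K \subset \Delta^{(n)}$ there is a constant $C \ge 0$ such that $\log\bigl(V_\tau(t)/V_\pi(t)\bigr) \ge -C$ for every $t \ge 0$ and every sequence $\mu$ with values in $K$. A portfolio $\pi$ is maximal in a family $\mathcal{S}$ of portfolios if $\pi \in \mathcal{S}$ and every $\tau \in \mathcal{S}$ that dominates $\pi$ on compacts equals $\pi$. A portfolio $\pi$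 is generated by a positive concave function $\Phi$ on $\Delta^{(n)}$ if $1 + \sum_{i=1}^n \frac{\pi_i(p)}{p_i}(q_i - p_i) \ge \frac{\Phi(q)}{\Phi(p)}$ for all $p, q \in \Delta^{(n)}$. A measure of diversity is a positive, $C^2$, concave function on $\Delta^{(n)}$ that is invariant under permutations of the coordinates. **Theorem.** Let $\pi$ be a portfolio generated by a measure of diversity $\Phi$ on $\Delta^{(n)}$. If $$\int_0^1 \frac{1}{\Phi\bigl(t\,e(1) + (1-t)\,\overline{e}\bigr)^2}\,dt = \infty,$$ then $\pi$ is maximal in the class of continuously differentiable portfolios $\tau : \Delta^{(n)} \to \overline{\Delta^{(n)}}$; that is, $\pi$ is continuously differentiable, and every continuously differentiable portfolio that dominates $\pi$ on compacts equals $\pi$. -/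

import Mathlib

open scoped BigOperators

/-- The open unit simplex `Δ⁽ⁿ⁾` of market weights; its closure is `stdSimplex ℝ (Fin n)`. -/
def openSimplex (n : ℕ) : Set (Fin n → ℝ) :=
  {p | (∀ i, 0 < p i) ∧ ∑ i, p i = 1}

/-- The vertex `e(i)` of the closed simplex. -/
def simplexVertex {n : ℕ} (i : Fin n) : Fin n → ℝ :=
  Pi.single i 1

/-- The barycenter `(1/n, …, 1/n)` of the simplex. -/
noncomputable def simplexBarycenter (n : ℕ) : Fin n → ℝ :=
  fun _ => 1 / (n : ℝ)

/-- A portfolio: a Borel measurable map from the open simplex to the closed simplex. It is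
represented by a function on `ℝⁿ` of which only the restriction to the open simplex matters. -/
structure IsPortfolio {n : ℕ} (π : (Fin n → ℝ) → (Fin n → ℝ)) : Prop where
  mapsTo : Set.MapsTo π (openSimplex n) (stdSimplex ℝ (Fin n))
  measurable : Measurable ((openSimplex n).domRestrict π)

/-- The relative return `1 + ⟨π(p)/p, q - p⟩` of `π` when the market weight moves from `p` to
`q`. -/
noncomputable def relativeReturn {n : ℕ} (π : (Fin n → ℝ) → (Fin n → ℝ)) (p q : Fin n → ℝ) : ℝ :=
  1 + ∑ i, π p i / p i * (q i - p i)

/-- The relative value process `V_π` along the market weight sequence `μ`. -/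
noncomputable def relativeValue {n : ℕ} (π : (Fin n → ℝ) → (Fin n → ℝ)) (μ : ℕ → (Fin n → ℝ)) :
    ℕ → ℝ
  | 0 => 1
  | t + 1 => relativeValue π μ t * relativeReturn π (μ t) (μ (t + 1))

/-- `τ` dominates `π` on compacts. -/
def DominatesOnCompacts {n : ℕ} (τ π : (Fin n → ℝ) → (Fin n → ℝ)) : Prop :=
  ∀ K : Set (Fin n → ℝ), IsCompact K → K ⊆ openSimplex n →
    ∃ C : ℝ, 0 ≤ C ∧ ∀ μ : ℕ → (Fin n → ℝ), (∀ t, μ t ∈ K) →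
      ∀ t, -C ≤ Real.log (relativeValue τ μ t / relativeValue π μ t)

/-- `π` belongs to the family `S` and no member of `S` other than `π` (as maps on the open
simplex) dominates `π` on compacts. -/
def IsMaximalPortfolio {n : ℕ} (S : Set ((Fin n → ℝ) → (Fin n → ℝ)))
    (π : (Fin n → ℝ) → (Fin n → ℝ)) : Prop :=
  π ∈ S ∧ ∀ τ ∈ S, DominatesOnCompacts τ π → Set.EqOn τ π (openSimplex n)

/-- The class of continuously differentiable portfolios. The open simplex is relatively open in
the hyperplane `∑ pᵢ = 1`, and `ContDiffOn` on it means continuous differentiability in the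
directions tangent to the simplex (one may extend constantly in a transversal direction). -/
def contDiffPortfolios (n : ℕ) : Set ((Fin n → ℝ) → (Fin n → ℝ)) :=
  {τ | IsPortfolio τ ∧ ContDiffOn ℝ 1 τ (openSimplex n)}

/-- The portfolio `π` is generated by the positive concave function `Φ`. -/
structure IsGeneratedBy {n : ℕ} (π : (Fin n → ℝ) → (Fin n → ℝ)) (Φ : (Fin n → ℝ) → ℝ) :
    Prop where
  pos : ∀ p ∈ openSimplex n, 0 < Φ p
  concaveOn : ConcaveOn ℝ (openSimplex n) Φ
  ratio_le : ∀ p ∈ openSimplex n, ∀ q ∈ openSimplex n, Φ q / Φ p ≤ relativeReturn π p q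

/-- A measure of diversity: a positive `C²` concave symmetric function on the open simplex. -/
structure IsMeasureOfDiversity {n : ℕ} (Φ : (Fin n → ℝ) → ℝ) : Prop where
  pos : ∀ p ∈ openSimplex n, 0 < Φ p
  contDiffOn : ContDiffOn ℝ 2 Φ (openSimplex n)
  concaveOn : ConcaveOn ℝ (openSimplex n) Φ
  symm : ∀ p ∈ openSimplex n, ∀ σ : Equiv.Perm (Fin n), Φ (p ∘ σ) = Φ p

/-! Repeating a round trip between two points turns a bounded loss into none: a portfolio `τ`
dominating `π` earns at least as much as `π` on every round trip
(`DominatesOnCompacts.roundTrip_le`). On the segment from `x` to `e(i)`, a portfolio acts through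
one growth rate. Write `a`, `b` for the rates of `τ`, `π`. Short round trips give, at second order,
`a' + a² ≤ b' + b²`. Moreover `b = φ'/φ`, where `φ` is `Φ` on the segment, so `W = φ²(a - b)`
satisfies `W' ≤ -W²/φ²`. If `W 0 < 0`, then `1/W` stays negative while growing at least as fast as
`∫ 1/φ²`, which contradicts divergence. Hence `a 0 ≥ b 0`, that is `τ x i ≥ π x i`.

Symmetry and concavity of `Φ` carry the divergence to every `x` and `i`. Both weight vectors sum to
`1`, so they coincide. -/

open Filter Topology MeasureTheory Set

/-! ### One-variable calculus: tangency, second-order comparison, Riccati inequality -/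

section OneVariable

/-- A differentiable function lying below an affine function with contact at `s` is tangent to
it. -/
theorem hasDerivAt_of_eventually_le_affine {f : ℝ → ℝ} {s c : ℝ} (hf : DifferentiableAt ℝ f s)
    (h : ∀ᶠ t in 𝓝 s, f t ≤ f s + (t - s) * c) : HasDerivAt f c s := by
  have hlin : HasDerivAt (fun t : ℝ => f s + (t - s) * c) c s := by
    simpa using (((hasDerivAt_id s).sub_const s).mul_const c).const_add (f s)
  have hmin : IsLocalMin (fun t => f s + (t - s) * c - f t) s := by
    filter_upwards [h] with t ht
    simp only [sub_self, zero_mul, add_zero]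
    linarith
  have hzero := hmin.hasDerivAt_eq_zero (hlin.sub hf.hasDerivAt)
  have : deriv f s = c := by linarith
  exact this ▸ hf.hasDerivAt

/-- Comparing the products `(1 + a(s)(t - s)) (1 + a(t)(s - t))` to second order as `t → s`. -/
theorem deriv_add_sq_le_of_eventually_cycle_le {a b : ℝ → ℝ} {s a' b' : ℝ}
    (ha : HasDerivAt a a' s) (hb : HasDerivAt b b' s)
    (h : ∀ᶠ t in 𝓝 s, (1 + (t - s) * b s) * (1 + (s - t) * b t) ≤
      (1 + (t - s) * a s) * (1 + (s - t) * a t)) :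
    a' + a s ^ 2 ≤ b' + b s ^ 2 := by
  have key : ∀ {c : ℝ → ℝ} {c' : ℝ}, HasDerivAt c c' s →
      Tendsto (fun t => slope c s t + c s * c t) (𝓝[≠] s) (𝓝 (c' + c s ^ 2)) := by
    intro c c' hc
    rw [sq]
    exact hc.tendsto_slope.add
      (tendsto_const_nhds.mul (hc.continuousAt.tendsto.mono_left nhdsWithin_le_nhds))
  refine le_of_tendsto_of_tendsto (key ha) (key hb) ?_
  filter_upwards [nhdsWithin_le_nhds h, self_mem_nhdsWithin] with t ht hts
  have hne : t - s ≠ 0 := sub_ne_zero.mpr hts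
  have hpos : 0 < (t - s) ^ 2 := by positivity
  -- The first-order terms of a round trip cancel; dividing the loss by `(t - s)²` leaves a quantity
  -- tending to `c' + c²`.
  have expand : ∀ c : ℝ → ℝ, (t - s) ^ 2 * (slope c s t + c s * c t) =
      1 - (1 + (t - s) * c s) * (1 + (s - t) * c t) := by
    intro c
    rw [slope_def_field]
    field_simp
    ring
  refine le_of_mul_le_mul_left ?_ hpos
  rw [expand, expand]
  linarith

/-- A solution of the Riccati inequality `W' ≤ -W² / φ²` on `[0, 1)` starts at a nonnegative value
if `∫ 1 / φ²` diverges. -/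
theorem nonneg_of_riccati_of_lintegral_eq_top {φ W W' : ℝ → ℝ}
    (hφ : ContinuousOn φ (Ico 0 1)) (hφpos : ∀ t ∈ Ico (0 : ℝ) 1, 0 < φ t)
    (hW : ContinuousOn W (Ico 0 1)) (hW' : ∀ t ∈ Ioo (0 : ℝ) 1, HasDerivAt W (W' t) t)
    (hric : ∀ t ∈ Ioo (0 : ℝ) 1, W' t ≤ -(W t ^ 2 / φ t ^ 2))
    (hint : ∫⁻ t in Ioo (0 : ℝ) 1, ENNReal.ofReal (1 / φ t ^ 2) = ⊤) : 0 ≤ W 0 := by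
  by_contra! hneg
  have h0 : (0 : ℝ) ∈ Ico (0 : ℝ) 1 := by simp
  have hanti : AntitoneOn W (Ico 0 1) := by
    refine antitoneOn_of_deriv_nonpos (convex_Ico 0 1) hW ?_ ?_
    · rw [interior_Ico]
      exact fun t ht => (hW' t ht).differentiableAt.differentiableWithinAt
    · rw [interior_Ico]
      intro t ht
      rw [(hW' t ht).deriv]
      exact (hric t ht).trans (neg_nonpos.mpr (by positivity))
  have hWneg : ∀ t ∈ Ico (0 : ℝ) 1, W t < 0 := fun t ht => (hanti h0 ht ht.1).trans_lt hneg
  set g : ℝ → ℝ := fun t => 1 / φ t ^ 2 with hg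
  have hgc : ContinuousOn g (Ico 0 1) :=
    continuousOn_const.div (hφ.pow 2) fun t ht => (pow_pos (hφpos t ht) 2).ne'
  have hgi : ∀ t ∈ Ico (0 : ℝ) 1, IntervalIntegrable g volume 0 t := by
    intro t ht
    refine (hgc.mono ?_).intervalIntegrable
    rw [uIcc_of_le ht.1]
    exact fun y hy => ⟨hy.1, hy.2.trans_lt ht.2⟩
  -- The Riccati inequality says `(1/W)' ≥ 1/φ²`, so this difference is nondecreasing.
  have hFd : ∀ t ∈ Ioo (0 : ℝ) 1, HasDerivAt (fun t => (W t)⁻¹ - ∫ y in (0 : ℝ)..t, g y)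
      (-W' t / W t ^ 2 - g t) t := by
    intro t ht
    have hmem := Ico_mem_nhds ht.1 ht.2
    refine ((hW' t ht).inv (hWneg t (Ioo_subset_Ico_self ht)).ne).sub
      (intervalIntegral.integral_hasDerivAt_right (hgi t (Ioo_subset_Ico_self ht)) ?_
        (hgc.continuousAt hmem))
    exact (hgc.mono Ioo_subset_Ico_self).stronglyMeasurableAtFilter isOpen_Ioo t ht
  have hFc : ContinuousOn (fun t => (W t)⁻¹ - ∫ y in (0 : ℝ)..t, g y) (Ico 0 1) := by
    refine (hW.inv₀ fun t ht => (hWneg t ht).ne).sub ?_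
    intro t ht
    obtain ⟨r, htr, hr1⟩ := exists_between ht.2
    have hr : r ∈ Ico (0 : ℝ) 1 := ⟨ht.1.trans htr.le, hr1⟩
    have hc := intervalIntegral.continuousOn_primitive_interval'
      (hgi r hr) (left_mem_uIcc (a := (0 : ℝ)) (b := r))
    rw [uIcc_of_le hr.1] at hc
    refine (hc t ⟨ht.1, htr.le⟩).mono_of_mem_nhdsWithin ?_
    filter_upwards [self_mem_nhdsWithin, nhdsWithin_le_nhds (Iio_mem_nhds htr)] with y hy hyr
    exact ⟨hy.1, le_of_lt hyr⟩
  have hmono : MonotoneOn (fun t => (W t)⁻¹ - ∫ y in (0 : ℝ)..t, g y) (Ico 0 1) := by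
    refine monotoneOn_of_deriv_nonneg (convex_Ico 0 1) hFc ?_ ?_
    · rw [interior_Ico]
      exact fun t ht => (hFd t ht).differentiableAt.differentiableWithinAt
    · rw [interior_Ico]
      intro t ht
      rw [(hFd t ht).deriv, sub_nonneg, le_div_iff₀ (by nlinarith [hWneg t (Ioo_subset_Ico_self ht)])]
      have := hric t ht
      have hid : g t * W t ^ 2 = W t ^ 2 / φ t ^ 2 := by rw [hg]; ring
      linarith
  have hbound : ∀ t ∈ Ico (0 : ℝ) 1, ∫ y in (0 : ℝ)..t, g y ≤ -(W 0)⁻¹ := by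
    intro t ht
    have h1 := hmono h0 ht ht.1
    have h2 : (W t)⁻¹ < 0 := inv_lt_zero.mpr (hWneg t ht)
    simp only [intervalIntegral.integral_same] at h1
    linarith
  -- Integrability of `g` is known only away from `1`; the uniform bound passes to `(0, 1)` through
  -- an increasing union.
  have hle : ∀ k : ℕ, ∫⁻ t in Ioc (0 : ℝ) (1 - 1 / ((k : ℝ) + 1)), ENNReal.ofReal (g t) ≤
      ENNReal.ofReal (-(W 0)⁻¹) := by
    intro k
    have hk : (0 : ℝ) < (k : ℝ) + 1 := by positivity
    have hr : 1 - 1 / ((k : ℝ) + 1) ∈ Ico (0 : ℝ) 1 := by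
      refine ⟨?_, by have := one_div_pos.mpr hk; linarith⟩
      rw [sub_nonneg, div_le_one hk]
      linarith [(Nat.cast_nonneg k : (0 : ℝ) ≤ k)]
    rw [← ofReal_integral_eq_lintegral_ofReal]
    · rw [← intervalIntegral.integral_of_le hr.1]
      exact ENNReal.ofReal_le_ofReal (hbound _ hr)
    · exact (intervalIntegrable_iff_integrableOn_Ioc_of_le hr.1).mp (hgi _ hr)
    · exact Eventually.of_forall fun t => by simp only [hg, Pi.zero_apply]; positivity
  have hUnion : Ioo (0 : ℝ) 1 ⊆ ⋃ k : ℕ, Ioc (0 : ℝ) (1 - 1 / ((k : ℝ) + 1)) := by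
    intro t ht
    obtain ⟨k, hk⟩ := exists_nat_one_div_lt (sub_pos.mpr ht.2)
    exact mem_iUnion.mpr ⟨k, ht.1, by linarith⟩
  have hdir : Directed (· ⊆ ·) fun k : ℕ => Ioc (0 : ℝ) (1 - 1 / ((k : ℝ) + 1)) := by
    refine Monotone.directed_le fun k l hkl => Ioc_subset_Ioc_right ?_
    have : (k : ℝ) ≤ l := by exact_mod_cast hkl
    have : 1 / ((l : ℝ) + 1) ≤ 1 / ((k : ℝ) + 1) := by gcongr
    linarith
  have htop : (⊤ : ENNReal) ≤ ENNReal.ofReal (-(W 0)⁻¹) := by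
    rw [← hint]
    refine (lintegral_mono_set hUnion).trans ?_
    rw [setLIntegral_iUnion_of_directed _ hdir]
    exact iSup_le hle
  exact ENNReal.ofReal_ne_top (top_le_iff.mp htop)

end OneVariable

/-! ### Relative returns and round trips -/

section Returns

variable {n : ℕ} {π τ : (Fin n → ℝ) → (Fin n → ℝ)} {p q : Fin n → ℝ}

/-- The return is the average of the ratios `q i / p i` with weights `π p i`. -/
theorem relativeReturn_pos (hπ : π p ∈ stdSimplex ℝ (Fin n)) (hp : p ∈ openSimplex n)
    (hq : q ∈ openSimplex n) : 0 < relativeReturn π p q := by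
  have heq : relativeReturn π p q = ∑ i, π p i * (q i / p i) := by
    rw [relativeReturn, ← hπ.2, ← Finset.sum_add_distrib]
    refine Finset.sum_congr rfl fun i _ => ?_
    have := (hp.1 i).ne'
    field_simp
    ring
  rw [heq]
  have hterm : ∀ i, 0 ≤ π p i * (q i / p i) := fun i =>
    mul_nonneg (hπ.1 i) (div_pos (hq.1 i) (hp.1 i)).le
  obtain ⟨i, hi⟩ : ∃ i, π p i ≠ 0 := by
    by_contra! h
    have := hπ.2
    simp [h] at this
  exact Finset.sum_pos' (fun i _ => hterm i)
    ⟨i, Finset.mem_univ i, mul_pos ((hπ.1 i).lt_of_ne' hi) (div_pos (hq.1 i) (hp.1 i))⟩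

/-- The weight sequence alternating between `p` and `q`. -/
def alternating (p q : Fin n → ℝ) (t : ℕ) : Fin n → ℝ :=
  if Even t then p else q

theorem relativeValue_alternating (π : (Fin n → ℝ) → (Fin n → ℝ)) (p q : Fin n → ℝ) (k : ℕ) :
    relativeValue π (alternating p q) (2 * k) =
      (relativeReturn π p q * relativeReturn π q p) ^ k := by
  induction k with
  | zero => simp [relativeValue]
  | succ k ih =>
    have h0 : alternating p q (2 * k) = p := by simp [alternating]
    have h1 : alternating p q (2 * k + 1) = q := by simp [alternating, parity_simps]
    have h2 : alternating p q (2 * k + 1 + 1) = p := by simp [alternating, parity_simps]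
    rw [show 2 * (k + 1) = 2 * k + 1 + 1 by ring, relativeValue, relativeValue, ih, h0, h1, h2]
    ring

/-- A portfolio that dominates `π` on compacts does at least as well as `π` on every round
trip. -/
theorem DominatesOnCompacts.roundTrip_le (h : DominatesOnCompacts τ π)
    (hτ : MapsTo τ (openSimplex n) (stdSimplex ℝ (Fin n)))
    (hπ : MapsTo π (openSimplex n) (stdSimplex ℝ (Fin n)))
    (hp : p ∈ openSimplex n) (hq : q ∈ openSimplex n) :
    relativeReturn π p q * relativeReturn π q p ≤
      relativeReturn τ p q * relativeReturn τ q p := by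
  have hpos : ∀ {σ : (Fin n → ℝ) → (Fin n → ℝ)},
      MapsTo σ (openSimplex n) (stdSimplex ℝ (Fin n)) →
      0 < relativeReturn σ p q * relativeReturn σ q p := fun hσ =>
    mul_pos (relativeReturn_pos (hσ hp) hp hq) (relativeReturn_pos (hσ hq) hq hp)
  obtain ⟨C, -, hC⟩ := h {p, q} (Set.toFinite _).isCompact (by
    rintro x (rfl | rfl) <;> assumption)
  have hbd := fun k : ℕ => hC (alternating p q)
    (fun t => by unfold alternating; split_ifs <;> simp) (2 * k)
  simp only [relativeValue_alternating, ← div_pow, Real.log_pow] at hbd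
  set r := Real.log (relativeReturn τ p q * relativeReturn τ q p /
    (relativeReturn π p q * relativeReturn π q p)) with hr
  -- After `k` round trips the log ratio is `k * r ≥ -C` with `C` independent of `k`.
  have hr0 : 0 ≤ r := by
    by_contra! hneg
    obtain ⟨k, hk⟩ := exists_nat_gt (C / -r)
    rw [div_lt_iff₀ (neg_pos.mpr hneg)] at hk
    linarith [hbd k]
  rw [hr, Real.log_nonneg_iff (div_pos (hpos hτ) (hpos hπ)), one_le_div (hpos hπ)] at hr0
  exact hr0

end Returns

/-! ### Segments ending in a vertex -/

section Rays

variable {n : ℕ} {π τ : (Fin n → ℝ) → (Fin n → ℝ)} {Φ : (Fin n → ℝ) → ℝ} {x : Fin n → ℝ}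
  {i : Fin n}

/-- The segment from `x` to the vertex `e(i)`. -/
noncomputable def vertexRay (x : Fin n → ℝ) (i : Fin n) (t : ℝ) : Fin n → ℝ :=
  t • simplexVertex i + (1 - t) • x

/-- The logarithmic growth rate of `π` along the segment from `x` to the vertex `e(i)`. -/
noncomputable def rayRate (π : (Fin n → ℝ) → (Fin n → ℝ)) (x : Fin n → ℝ) (i : Fin n) (t : ℝ) :
    ℝ :=
  ∑ j, π (vertexRay x i t) j / vertexRay x i t j * (simplexVertex i j - x j)

theorem vertexRay_apply (x : Fin n → ℝ) (i : Fin n) (t : ℝ) (j : Fin n) :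
    vertexRay x i t j = t * simplexVertex i j + (1 - t) * x j := by
  simp [vertexRay]

@[simp]
theorem vertexRay_zero (x : Fin n → ℝ) (i : Fin n) : vertexRay x i 0 = x := by
  simp [vertexRay]

theorem simplexVertex_mem (i : Fin n) : simplexVertex i ∈ stdSimplex ℝ (Fin n) :=
  single_mem_stdSimplex ℝ i

theorem vertexRay_mem (hx : x ∈ openSimplex n) (i : Fin n) {t : ℝ} (ht : t ∈ Ico (0 : ℝ) 1) :
    vertexRay x i t ∈ openSimplex n := by
  have hv := simplexVertex_mem i
  refine ⟨fun j => ?_, ?_⟩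
  · rw [vertexRay_apply]
    exact add_pos_of_nonneg_of_pos (mul_nonneg ht.1 (hv.1 j))
      (mul_pos (sub_pos.mpr ht.2) (hx.1 j))
  · simp only [vertexRay_apply, Finset.sum_add_distrib, ← Finset.mul_sum, hv.2, hx.2]
    ring

theorem contDiff_vertexRay (x : Fin n → ℝ) (i : Fin n) : ContDiff ℝ 2 (vertexRay x i) := by
  unfold vertexRay
  fun_prop

theorem relativeReturn_vertexRay (π : (Fin n → ℝ) → (Fin n → ℝ)) (x : Fin n → ℝ) (i : Fin n)
    (s t : ℝ) : relativeReturn π (vertexRay x i s) (vertexRay x i t) =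
      1 + (t - s) * rayRate π x i s := by
  rw [relativeReturn, rayRate, Finset.mul_sum]
  congr 1
  refine Finset.sum_congr rfl fun j _ => ?_
  have : vertexRay x i t j - vertexRay x i s j = (t - s) * (simplexVertex i j - x j) := by
    rw [vertexRay_apply, vertexRay_apply]
    ring
  rw [this]
  ring

theorem rayRate_zero (hx : x ∈ openSimplex n) (hπ : π x ∈ stdSimplex ℝ (Fin n)) (i : Fin n) :
    rayRate π x i 0 = π x i / x i - 1 := by
  simp only [rayRate, vertexRay_zero, mul_sub, Finset.sum_sub_distrib]
  congr 1
  · simp [simplexVertex, Pi.single_apply]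
  · rw [← hπ.2]
    exact Finset.sum_congr rfl fun j _ => div_mul_cancel₀ _ (hx.1 j).ne'

theorem contDiffOn_rayRate (hx : x ∈ openSimplex n) (i : Fin n)
    (hπ : ContDiffOn ℝ 1 π (openSimplex n)) : ContDiffOn ℝ 1 (rayRate π x i) (Ico 0 1) := by
  have hray : ContDiffOn ℝ 1 (vertexRay x i) (Ico 0 1) :=
    ((contDiff_vertexRay x i).of_le one_le_two).contDiffOn
  have hcomp : ContDiffOn ℝ 1 (fun t => π (vertexRay x i t)) (Ico 0 1) :=
    hπ.comp hray fun t ht => vertexRay_mem hx i ht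
  unfold rayRate
  refine ContDiffOn.sum fun j _ => ContDiffOn.mul ?_ contDiffOn_const
  exact (contDiffOn_pi.mp hcomp j).div (contDiffOn_pi.mp hray j)
    fun t ht => ((vertexRay_mem hx i ht).1 j).ne'

/-- The logarithmic growth rate of a generated portfolio is the logarithmic derivative of its
generating function. -/
theorem IsGeneratedBy.hasDerivAt_ray (hgen : IsGeneratedBy π Φ)
    (hΦ : ContDiffOn ℝ 2 Φ (openSimplex n)) (hx : x ∈ openSimplex n) (i : Fin n) {s : ℝ}
    (hs : s ∈ Ioo (0 : ℝ) 1) :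
    HasDerivAt (fun t => Φ (vertexRay x i t)) (Φ (vertexRay x i s) * rayRate π x i s) s := by
  have hmem : Ico (0 : ℝ) 1 ∈ 𝓝 s := Ico_mem_nhds hs.1 hs.2
  have hcomp : ContDiffOn ℝ 2 (fun t => Φ (vertexRay x i t)) (Ico 0 1) :=
    hΦ.comp (contDiff_vertexRay x i).contDiffOn fun t ht => vertexRay_mem hx i ht
  refine hasDerivAt_of_eventually_le_affine
    ((hcomp.contDiffAt hmem).differentiableAt (by norm_num)) ?_
  filter_upwards [hmem] with t ht
  have hp := vertexRay_mem hx i (Ioo_subset_Ico_self hs)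
  have := hgen.ratio_le _ hp _ (vertexRay_mem hx i ht)
  rw [relativeReturn_vertexRay, div_le_iff₀ (hgen.pos _ hp)] at this
  linarith

/-- Divergence of the integral along the segment from the barycenter to one vertex gives
divergence along every segment ending in a vertex. -/
theorem IsMeasureOfDiversity.lintegral_ray_eq_top (hΦ : IsMeasureOfDiversity Φ) {i₀ : Fin n}
    (hint : ∫⁻ t in Ioo (0 : ℝ) 1,
      ENNReal.ofReal (1 / Φ (vertexRay (simplexBarycenter n) i₀ t) ^ 2) = ⊤)
    (hx : x ∈ openSimplex n) (i : Fin n) :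
    ∫⁻ t in Ioo (0 : ℝ) 1, ENNReal.ofReal (1 / Φ (vertexRay x i t) ^ 2) = ⊤ := by
  have hn : (0 : ℝ) < n := by exact_mod_cast i.pos
  have hbar : simplexBarycenter n ∈ openSimplex n := by
    refine ⟨fun j => by simpa [simplexBarycenter] using i.pos, ?_⟩
    simp [simplexBarycenter, hn.ne']
  have hsymm : ∀ t ∈ Ico (0 : ℝ) 1, Φ (vertexRay (simplexBarycenter n) i₀ t) =
      Φ (vertexRay (simplexBarycenter n) i t) := by
    intro t ht
    rw [← hΦ.symm _ (vertexRay_mem hbar i₀ ht) (Equiv.swap i i₀)]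
    congr 1
    ext j
    simp only [Function.comp_apply, vertexRay_apply, simplexBarycenter, simplexVertex,
      Pi.single_apply, Equiv.swap_apply_eq_iff, Equiv.swap_apply_right]
  have hn1 : (1 : ℝ) ≤ n := by exact_mod_cast i.pos
  -- Any `l < 1 / n` works: `l * x j ≤ l < 1 / n` makes the barycenter a convex combination of `x`
  -- and a point `y` of the open simplex.
  set l : ℝ := 1 / (2 * n) with hl
  have hl0 : 0 < l := by positivity
  have hl1 : l < 1 := by
    rw [hl, div_lt_one (by positivity)]
    linarith
  have hx1 : ∀ j, x j ≤ 1 := fun j =>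
    hx.2 ▸ Finset.single_le_sum (fun k _ => (hx.1 k).le) (Finset.mem_univ j)
  set y : Fin n → ℝ := fun j => (1 / (n : ℝ) - l * x j) / (1 - l) with hy
  have hymem : y ∈ openSimplex n := by
    refine ⟨fun j => div_pos ?_ (sub_pos.mpr hl1), ?_⟩
    · have h1 : l * x j ≤ l := mul_le_of_le_one_right hl0.le (hx1 j)
      have h2 : 1 / (n : ℝ) = 2 * l := by rw [hl]; field_simp
      linarith
    · rw [hy, ← Finset.sum_div, Finset.sum_sub_distrib, ← Finset.mul_sum, hx.2]
      have : 1 - l ≠ 0 := (sub_pos.mpr hl1).ne'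
      simp [hn.ne', this]
  have hcomb : ∀ t, vertexRay (simplexBarycenter n) i t =
      l • vertexRay x i t + (1 - l) • vertexRay y i t := by
    intro t
    have : 1 - l ≠ 0 := (sub_pos.mpr hl1).ne'
    ext j
    simp only [vertexRay_apply, Pi.add_apply, Pi.smul_apply, smul_eq_mul, hy, simplexBarycenter]
    field_simp
    ring
  -- Concavity, with the positive contribution of the segment from `y` discarded.
  have hle : ∀ t ∈ Ioo (0 : ℝ) 1,
      l * Φ (vertexRay x i t) ≤ Φ (vertexRay (simplexBarycenter n) i t) := by
    intro t ht
    have hxm := vertexRay_mem hx i (Ioo_subset_Ico_self ht)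
    have hym := vertexRay_mem hymem i (Ioo_subset_Ico_self ht)
    have hconc := hΦ.concaveOn.2 hxm hym hl0.le (sub_pos.mpr hl1).le (by ring)
    rw [← hcomb, smul_eq_mul, smul_eq_mul] at hconc
    have := mul_pos (sub_pos.mpr hl1) (hΦ.pos _ hym)
    linarith
  have hbound : ∫⁻ t in Ioo (0 : ℝ) 1,
      ENNReal.ofReal (1 / Φ (vertexRay (simplexBarycenter n) i₀ t) ^ 2) ≤
      ENNReal.ofReal (1 / l ^ 2) *
        ∫⁻ t in Ioo (0 : ℝ) 1, ENNReal.ofReal (1 / Φ (vertexRay x i t) ^ 2) := by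
    rw [← lintegral_const_mul' _ _ ENNReal.ofReal_ne_top]
    refine setLIntegral_mono' measurableSet_Ioo fun t ht => ?_
    rw [← ENNReal.ofReal_mul (by positivity), hsymm t (Ioo_subset_Ico_self ht),
      div_mul_div_comm, one_mul, ← mul_pow]
    have hpos := mul_pos hl0 (hΦ.pos _ (vertexRay_mem hx i (Ioo_subset_Ico_self ht)))
    refine ENNReal.ofReal_le_ofReal ?_
    exact one_div_le_one_div_of_le (by positivity) (pow_le_pow_left₀ hpos.le (hle t ht) 2)
  rw [hint, top_le_iff, ENNReal.mul_eq_top] at hbound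
  rcases hbound with h | h
  · exact h.2
  · exact absurd h.1 ENNReal.ofReal_ne_top

end Rays

/-! ### Smoothness of generated portfolios -/

section Regularity

variable {n : ℕ} {π : (Fin n → ℝ) → (Fin n → ℝ)} {Φ : (Fin n → ℝ) → ℝ}

/-- The extension of a function on the open simplex to the positive orthant that is constant along
rays through the origin. -/
noncomputable def homogeneousExtension (Φ : (Fin n → ℝ) → ℝ) (p : Fin n → ℝ) : ℝ :=
  Φ fun i => p i / ∑ j, p j

theorem homogeneousExtension_eq {p : Fin n → ℝ} (hp : p ∈ openSimplex n) :
    homogeneousExtension Φ p = Φ p := by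
  simp [homogeneousExtension, hp.2]

theorem isOpen_positiveOrthant : IsOpen {p : Fin n → ℝ | ∀ i, 0 < p i} := by
  simp only [Set.ofPred_forall]
  exact isOpen_iInter_of_finite fun i => isOpen_lt continuous_const (continuous_apply i)

theorem contDiffOn_homogeneousExtension {k : WithTop ℕ∞} (hΦ : ContDiffOn ℝ k Φ (openSimplex n)) :
    ContDiffOn ℝ k (homogeneousExtension Φ) {p : Fin n → ℝ | ∀ i, 0 < p i} := by
  rcases isEmpty_or_nonempty (Fin n) with h | h
  · exact contDiffOn_const.congr fun p _ => congrArg _ (Subsingleton.elim p 0)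
  have hsum : ∀ p ∈ {p : Fin n → ℝ | ∀ i, 0 < p i}, 0 < ∑ j, p j := fun p hp =>
    Finset.sum_pos (fun i _ => hp i) Finset.univ_nonempty
  refine hΦ.comp (g := Φ) (f := fun p : Fin n → ℝ => fun i => p i / ∑ j, p j) ?_ ?_
  · refine contDiffOn_pi.mpr fun i => ContDiffOn.div ?_ ?_ fun p hp => (hsum p hp).ne'
    · exact (contDiff_apply ℝ ℝ i).contDiffOn
    · exact (ContDiff.sum fun j _ => contDiff_apply ℝ ℝ j).contDiffOn
  · intro p hp
    refine ⟨fun i => div_pos (hp i) (hsum p hp), ?_⟩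
    rw [← Finset.sum_div]
    exact div_self (hsum p hp).ne'

/-- The generating inequality places `Φ` below an affine function touching it at `p`, which fixes
its derivative towards each vertex. The extension to an open set makes `fderiv` meaningful. -/
theorem IsGeneratedBy.apply_eq_fderiv (hgen : IsGeneratedBy π Φ)
    (hπ : MapsTo π (openSimplex n) (stdSimplex ℝ (Fin n)))
    (hΦ : ContDiffOn ℝ 2 Φ (openSimplex n)) {p : Fin n → ℝ} (hp : p ∈ openSimplex n)
    (i : Fin n) :
    π p i = p i * (1 + fderiv ℝ (homogeneousExtension Φ) p (simplexVertex i - p) /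
      homogeneousExtension Φ p) := by
  have hray : HasDerivAt (vertexRay p i) (simplexVertex i - p) 0 := by
    have h := ((hasDerivAt_id (0 : ℝ)).smul_const (simplexVertex i)).add
      (((hasDerivAt_id (0 : ℝ)).const_sub 1).smul_const p)
    rw [one_smul, neg_one_smul, ← sub_eq_add_neg] at h
    exact h
  have hdiff : DifferentiableAt ℝ (homogeneousExtension Φ) (vertexRay p i 0) := by
    rw [vertexRay_zero]
    exact ((contDiffOn_homogeneousExtension hΦ).contDiffAt
      (isOpen_positiveOrthant.mem_nhds hp.1)).differentiableAt (by norm_num)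
  have hcomp := hdiff.hasFDerivAt.comp_hasDerivAt (0 : ℝ) hray
  -- Small negative `t` also stay in the simplex, so the contact at `0` is two-sided.
  have hnear : ∀ᶠ t in 𝓝 (0 : ℝ), vertexRay p i t ∈ openSimplex n := by
    have hc : ContinuousAt (vertexRay p i) 0 := (contDiff_vertexRay p i).continuous.continuousAt
    have hmem : {p : Fin n → ℝ | ∀ i, 0 < p i} ∈ 𝓝 (vertexRay p i 0) := by
      rw [vertexRay_zero]
      exact isOpen_positiveOrthant.mem_nhds hp.1
    filter_upwards [hc hmem] with t ht
    refine ⟨ht, ?_⟩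
    simp only [vertexRay_apply, Finset.sum_add_distrib, ← Finset.mul_sum,
      (simplexVertex_mem i).2, hp.2]
    ring
  have htangent := hasDerivAt_of_eventually_le_affine (c := Φ p * rayRate π p i 0)
    hcomp.differentiableAt (by
      filter_upwards [hnear] with t ht
      have h := hgen.ratio_le p hp _ ht
      have hret := relativeReturn_vertexRay π p i 0 t
      rw [vertexRay_zero] at hret
      rw [hret, div_le_iff₀ (hgen.pos p hp)] at h
      simp only [Function.comp_apply, vertexRay_zero, homogeneousExtension_eq ht,
        homogeneousExtension_eq hp]
      linarith)
  have heq := hcomp.unique htangent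
  rw [vertexRay_zero, rayRate_zero hp (hπ hp)] at heq
  have h1 := (hgen.pos p hp).ne'
  have h2 := (hp.1 i).ne'
  rw [heq, homogeneousExtension_eq hp]
  field_simp
  ring

/-- A portfolio generated by a `C²` function is continuously differentiable. -/
theorem IsGeneratedBy.contDiffOn (hgen : IsGeneratedBy π Φ)
    (hπ : MapsTo π (openSimplex n) (stdSimplex ℝ (Fin n)))
    (hΦ : ContDiffOn ℝ 2 Φ (openSimplex n)) : ContDiffOn ℝ 1 π (openSimplex n) := by
  have hsub : openSimplex n ⊆ {p : Fin n → ℝ | ∀ i, 0 < p i} := fun p hp => hp.1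
  have hext := contDiffOn_homogeneousExtension hΦ
  have hderiv : ContDiffOn ℝ 1 (fderiv ℝ (homogeneousExtension Φ)) (openSimplex n) :=
    (hext.fderiv_of_isOpen isOpen_positiveOrthant (by norm_num)).mono hsub
  refine contDiffOn_pi.mpr fun i => ContDiffOn.congr ?_
    fun p hp => hgen.apply_eq_fderiv hπ hΦ hp i
  refine (contDiff_apply ℝ ℝ i).contDiffOn.mul (contDiffOn_const.add (ContDiffOn.div ?_ ?_ ?_))
  · exact hderiv.clm_apply (contDiff_const.sub contDiff_id).contDiffOn
  · exact (hext.mono hsub).of_le one_le_two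
  · intro p hp
    rw [homogeneousExtension_eq hp]
    exact (hgen.pos p hp).ne'

end Regularity

/-! ### Comparison of weights and maximality -/

/-- If `∫ 1 / Φ²` diverges along the segment from `x` to the vertex `e(i)`, a portfolio dominating
the portfolio generated by `Φ` puts at least as much weight on coordinate `i` at `x`. -/
theorem DominatesOnCompacts.apply_le_of_lintegral_eq_top {n : ℕ}
    {π τ : (Fin n → ℝ) → (Fin n → ℝ)} {Φ : (Fin n → ℝ) → ℝ} {x : Fin n → ℝ} {i : Fin n}
    (h : DominatesOnCompacts τ π) (hgen : IsGeneratedBy π Φ)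
    (hΦ : ContDiffOn ℝ 2 Φ (openSimplex n))
    (hτ : MapsTo τ (openSimplex n) (stdSimplex ℝ (Fin n)))
    (hπ : MapsTo π (openSimplex n) (stdSimplex ℝ (Fin n)))
    (hτc : ContDiffOn ℝ 1 τ (openSimplex n)) (hx : x ∈ openSimplex n)
    (hint : ∫⁻ t in Ioo (0 : ℝ) 1, ENNReal.ofReal (1 / Φ (vertexRay x i t) ^ 2) = ⊤) :
    π x i ≤ τ x i := by
  set a := rayRate τ x i with ha
  set b := rayRate π x i with hb
  set φ : ℝ → ℝ := fun t => Φ (vertexRay x i t) with hφ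
  have hac : ContDiffOn ℝ 1 a (Ico 0 1) := contDiffOn_rayRate hx i hτc
  have hbc : ContDiffOn ℝ 1 b (Ico 0 1) := contDiffOn_rayRate hx i (hgen.contDiffOn hπ hΦ)
  have hφc : ContinuousOn φ (Ico 0 1) :=
    hΦ.continuousOn.comp (contDiff_vertexRay x i).continuous.continuousOn
      fun t ht => vertexRay_mem hx i ht
  have hφpos : ∀ t ∈ Ico (0 : ℝ) 1, 0 < φ t := fun t ht => hgen.pos _ (vertexRay_mem hx i ht)
  have hderiv : ∀ {c : ℝ → ℝ}, ContDiffOn ℝ 1 c (Ico 0 1) → ∀ t ∈ Ioo (0 : ℝ) 1,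
      HasDerivAt c (deriv c t) t := fun hc t ht =>
    ((hc.contDiffAt (Ico_mem_nhds ht.1 ht.2)).differentiableAt (by norm_num)).hasDerivAt
  have hsecond : ∀ t ∈ Ioo (0 : ℝ) 1, deriv a t + a t ^ 2 ≤ deriv b t + b t ^ 2 := by
    intro s hs
    refine deriv_add_sq_le_of_eventually_cycle_le (hderiv hac s hs) (hderiv hbc s hs) ?_
    filter_upwards [Ico_mem_nhds hs.1 hs.2] with t ht
    have := h.roundTrip_le hτ hπ (vertexRay_mem hx i (Ioo_subset_Ico_self hs))
      (vertexRay_mem hx i ht)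
    simpa only [relativeReturn_vertexRay] using this
  have hW0 := nonneg_of_riccati_of_lintegral_eq_top (φ := φ)
    (W := fun t => φ t ^ 2 * (a t - b t))
    (W' := fun t => 2 * φ t * (φ t * b t) * (a t - b t) + φ t ^ 2 * (deriv a t - deriv b t))
    hφc hφpos ((hφc.pow 2).mul (hac.continuousOn.sub hbc.continuousOn))
    (fun t ht => by
      have h1 := ((hgen.hasDerivAt_ray hΦ hx i ht).pow 2).mul
        ((hderiv hac t ht).sub (hderiv hbc t ht))
      refine h1.congr_deriv ?_
      simp [hφ, hb, ha])
    (fun t ht => by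
      have hpos := hφpos t (Ioo_subset_Ico_self ht)
      have hid : (φ t ^ 2 * (a t - b t)) ^ 2 / φ t ^ 2 = φ t ^ 2 * (a t - b t) ^ 2 := by
        field_simp
      simp only [hid]
      -- The identity behind the bound is `2b(a - b) + b² - a² = -(a - b)²`.
      nlinarith [mul_le_mul_of_nonneg_left (hsecond t ht) (sq_nonneg (φ t))])
    hint
  have h0 : 0 < φ 0 ^ 2 := pow_pos (hφpos 0 (by simp)) 2
  have hab := nonneg_of_mul_nonneg_right hW0 h0
  rw [ha, hb, rayRate_zero hx (hτ hx), rayRate_zero hx (hπ hx)] at hab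
  have : π x i / x i ≤ τ x i / x i := by linarith
  exact (div_le_div_iff_of_pos_right (hx.1 i)).mp this

theorem theorem1p1 (n : ℕ) (hn : 2 ≤ n) (π : (Fin n → ℝ) → (Fin n → ℝ)) (Φ : (Fin n → ℝ) → ℝ)
    (hπ : IsPortfolio π) (hΦ : IsMeasureOfDiversity Φ) (hgen : IsGeneratedBy π Φ)
    (hint : ∫⁻ t in Set.Ioo (0 : ℝ) 1,
      ENNReal.ofReal (1 / Φ (t • simplexVertex (⟨0, by omega⟩ : Fin n)
        + (1 - t) • simplexBarycenter n) ^ 2) = ⊤) :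
    IsMaximalPortfolio (contDiffPortfolios n) π := by
  refine ⟨⟨hπ, hgen.contDiffOn hπ.mapsTo hΦ.contDiffOn⟩, ?_⟩
  rintro τ ⟨hτ, hτc⟩ hdom x hx
  have hle : ∀ i ∈ Finset.univ, π x i ≤ τ x i := fun i _ =>
    hdom.apply_le_of_lintegral_eq_top hgen hΦ.contDiffOn hτ.mapsTo hπ.mapsTo hτc hx
      (hΦ.lintegral_ray_eq_top hint hx i)
  have hsum : ∑ i, π x i = ∑ i, τ x i := by
    rw [(hπ.mapsTo hx).2, (hτ.mapsTo hx).2]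
  funext i
  exact ((Finset.sum_eq_sum_iff_of_le hle).mp hsum i (Finset.mem_univ i)).symm
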